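/- Let $a>0$, let $q\in C[-a,a]$ be complex-valued, and let $f\in C^2(-a,a)\cap C^1[-a,a]$ be a complex-valued solution of $f''-qf=0$ on $(-a,a)$ with $f(x)\neq 0$ for all $x\in[-a,a]$ and $f(0)=1$. Put $h=f'(0)$ and $q_1=q$, $q_2=2(f'/f)^2-q$ on $[-a,a]$. For $p\in C[-a,a]$ let $H_p$ be the unique solution, on $|u|+|v|\le a$, of the Goursat problem $$\frac{\partial^2 H_p}{\partial u\,\partial v}=p(u+v)H_p(u,v),\qquad H_p(u,0)=\frac12\int_0^u p(s)\,ds,\qquad H_p(0,v)=0,$$ (continuous on the closed domain, with the equation holding in its interior), let $K_p(x,t)=H_p\big(\tfrac{x+t}2,\tfrac{x-t}2\big)$, and for $c\in\mathbb C$ define $$K_p(x,t;c)=\frac c2+K_p(x,t)+\frac c2\int_t^x\big(K_p(x,s)-K_p(x,-s)\big)\,ds,$$ $$\mathbf T_{p;c}u(x)=u(x)+\int_{-x}^{x}K_p(x,t;c)\,u(t)\,dt,\qquad u\in C[-a,a],\ x\in[-a,a].$$ Let $\mathbf T_1=\mathbf T_{q_1;h}$ and $\mathbf T_2=\mathbf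 T_{q_2;-h}$. For a function $g$ on $[-a,a]$ define the generalized derivatives, as long as the derivatives involved exist on $[-a,a]$ (one-sided at $\pm a$), by $$\gamma_0(g)=g,\qquad \gamma_k(g)=\big(f^2\big)^{(-1)^{k-1}}\big(\gamma_{k-1}(g)\big)',\quad k\ge1.$$ Let $n\ge 0$ be an integer, $u\in C^n[-a,a]$ complex-valued, and $g=\frac1f\mathbf T_1u$. Then $\gamma_0(g),\dots,\gamma_n(g)$ are all defined (that is, $\gamma_k(g)$ is differentiable on $[-a,a]$ for every $k<n$), and on $[-a,a]$ $$\gamma_k(g)=f\,\mathbf T_2u^{(k)}\quad\text{for odd }k\le n,\qquad \gamma_k(g)=\frac1f\,\mathbf T_1u^{(k)}\quad\text{for even }k\le n.$$ -/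

import Mathlib

open Set

noncomputable section

namespace Transmutation

/-- `H` is a classical solution of the Goursat problem
`∂²H/∂u∂v = q(u+v) H`, `H(u,0) = ½ ∫₀ᵘ q(s) ds`, `H(0,v) = 0`.
In the variables `x = u + v`, `t = u - v`, the domain `|u| + |v| ≤ a` is the square
`-a ≤ x ≤ a`, `-a ≤ t ≤ a`. The function `H` is continuous on the closed domain; the partial
derivative `Hv = ∂H/∂v` and the mixed derivative `∂Hv/∂u` exist in the open domain. -/
structure IsGoursatSolution (a : ℝ) (q : ℝ → ℂ) (H : ℝ → ℝ → ℂ) : Prop where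
  continuousOn : ContinuousOn (fun p : ℝ × ℝ => H p.1 p.2) {p | |p.1| + |p.2| ≤ a}
  equation : ∃ Hv : ℝ → ℝ → ℂ, ∀ u v : ℝ, |u| + |v| < a →
    HasDerivAt (fun v' : ℝ => H u v') (Hv u v) v ∧
    HasDerivAt (fun u' : ℝ => Hv u' v) (q (u + v) * H u v) u
  left_data : ∀ u ∈ Icc (-a) a, H u 0 = (1 / 2) * ∫ s in (0 : ℝ)..u, q s
  right_data : ∀ v ∈ Icc (-a) a, H 0 v = 0

open Classical in
/-- The solution of the Goursat problem. For `q` continuous on `[-a, a]` it exists, and it is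
determined on the whole domain `|u| + |v| ≤ a`. -/
def goursatSolution (a : ℝ) (q : ℝ → ℂ) : ℝ → ℝ → ℂ :=
  if h : ∃ H, IsGoursatSolution a q H then h.choose else 0

/-- The kernel `K(x,t) = H((x+t)/2, (x-t)/2)`. -/
def kernel (a : ℝ) (q : ℝ → ℂ) (x t : ℝ) : ℂ :=
  goursatSolution a q ((x + t) / 2) ((x - t) / 2)

/-- The parametrized kernel
`K(x,t;h) = h/2 + K(x,t) + (h/2) ∫ₜˣ (K(x,s) - K(x,-s)) ds`. -/
def paramKernel (a : ℝ) (q : ℝ → ℂ) (h : ℂ) (x t : ℝ) : ℂ :=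
  h / 2 + kernel a q x t + (h / 2) * ∫ s in t..x, (kernel a q x s - kernel a q x (-s))

/-- The Volterra operator `T_h u(x) = u(x) + ∫₋ₓˣ K(x,t;h) u(t) dt` attached to the potential `q`
on `[-a, a]`. -/
def transmutation (a : ℝ) (q : ℝ → ℂ) (h : ℂ) (u : ℝ → ℂ) (x : ℝ) : ℂ :=
  u x + ∫ t in (-x)..x, paramKernel a q h x t * u t

/-- The Darboux-transformed potential `2 (f'/f)² - q`; derivatives at `±a` are one-sided. -/
def darbouxPotential (a : ℝ) (q f : ℝ → ℂ) (x : ℝ) : ℂ :=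
  2 * (derivWithin f (Icc (-a) a) x / f x) ^ 2 - q x

/-- The generalized derivatives `γ₀(g) = g`, `γₖ(g) = (f²)^((-1)^(k-1)) · (γₖ₋₁(g))'` on `[-a, a]`;
derivatives at `±a` are one-sided. -/
def genDeriv (a : ℝ) (f g : ℝ → ℂ) : ℕ → ℝ → ℂ
  | 0 => g
  | k + 1 => fun x =>
      ((f x) ^ 2) ^ ((-1 : ℤ) ^ k) * derivWithin (genDeriv a f g k) (Icc (-a) a) x

end Transmutation

end

noncomputable section

namespace Transmutation

open MeasureTheory Filter Topology Function

/-! Put φ = f'/f. Then q₁ = φ² + φ', q₂ = φ² - φ' and φ(0) = h, so passing from φ to -φ (from f to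
1/f) exchanges T₁ and T₂. Everything follows from one intertwining relation,
`hasDerivWithinAt_transmutation`: (T₁u)' = φ T₁u + T₂u'. Dividing by f gives (T₁u/f)' = T₂u'/f; the
version for -φ gives (f T₂u)' = f T₁u'; induction on k alternates the two.

The relation comes from factoring the Goursat problem into the first order system S_u = φ(u+v)D, D_v
= φ(u+v)S with S(0,v) = 0, D(u,0) = φ(u). Then (S+D)/2 solves the second order equation for φ² + φ'.
The parametrized kernel with c = φ(0) solves the same equation with the same values on both axes, so
uniqueness (`SolvesGoursatEquation.unique`) makes the two equal (`IsDiracGoursat.paramKernel_eq`).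
Since (S,-D) belongs to -φ, the kernel of T₂ is (S-D)/2.

Hence T₁u = u + A[u] + B[u] and T₂u = u + A[u] - B[u], with A, B built from S, D. The system yields
A[u]' = φB[u] + A[u'] and B[u]' = φu + φA[u] - B[u'], and adding these to u' gives the relation.
This needs only u in C¹ and q continuous. Data on [-a,a] are extended to the line so that existence
can be proved on the whole plane. -/

/-! ### Calculus of parameter integrals. -/

/-- Differentiation under the integral sign for jointly continuous data. -/
theorem hasDerivAt_integral_param {g g' : ℝ → ℝ → ℂ} (hg : Continuous (uncurry g))
    (hg' : Continuous (uncurry g')) (hd : ∀ x s, HasDerivAt (fun y => g y s) (g' x s) x)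
    (b x : ℝ) :
    HasDerivAt (fun y => ∫ s in (0 : ℝ)..b, g y s) (∫ s in (0 : ℝ)..b, g' x s) x := by
  have hK : IsCompact (Metric.closedBall x 1 ×ˢ uIcc 0 b) :=
    (isCompact_closedBall x 1).prod isCompact_uIcc
  obtain ⟨C, hC⟩ := hK.exists_bound_of_continuousOn hg'.continuousOn
  refine (intervalIntegral.hasDerivAt_integral_of_dominated_loc_of_deriv_le
    (F := g) (F' := g') (bound := fun _ => C) (Metric.closedBall_mem_nhds x one_pos)
    ?_ ?_ ?_ ?_ ?_ ?_).2
  · exact Eventually.of_forall fun y => (Continuous.uncurry_left y hg).aestronglyMeasurable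
  · exact (Continuous.uncurry_left x hg).intervalIntegrable _ _
  · exact (Continuous.uncurry_left x hg').aestronglyMeasurable
  · exact Eventually.of_forall fun s hs y hy => hC (y, s) ⟨hy, uIoc_subset_uIcc hs⟩
  · exact intervalIntegrable_const
  · exact Eventually.of_forall fun s _ y _ => hd y s

/-- The Leibniz rule with a variable upper limit. -/
theorem hasDerivAt_integral_param_self {g g' : ℝ → ℝ → ℂ} (hg : Continuous (uncurry g))
    (hg' : Continuous (uncurry g')) (hd : ∀ x s, HasDerivAt (fun y => g y s) (g' x s) x)
    (x : ℝ) :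
    HasDerivAt (fun y => ∫ s in (0 : ℝ)..y, g y s)
      (g x x + ∫ s in (0 : ℝ)..x, g' x s) x := by
  -- The integral is a function of parameter and upper limit with continuous partial derivatives,
  -- hence jointly differentiable; the chain rule along the diagonal y ↦ (y, y) finishes.
  have h := hasStrictFDerivAt_uncurry_coprod (𝕜 := ℝ) (u := (x, x))
    (f := fun y b => ∫ s in (0 : ℝ)..b, g y s)
    (f₁ := fun y b => ContinuousLinearMap.toSpanSingleton ℝ (∫ s in (0 : ℝ)..b, g' y s))
    (f₂ := fun y b => ContinuousLinearMap.toSpanSingleton ℝ (g y b))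
    (Eventually.of_forall fun p => (hasDerivAt_integral_param hg hg' hd p.2 p.1).hasFDerivAt)
    (Eventually.of_forall fun p =>
      ((Continuous.uncurry_left p.1 hg).integral_hasStrictDerivAt 0 p.2).hasDerivAt.hasFDerivAt)
    (by
      refine Continuous.continuousAt ?_
      have h1 : Continuous fun p : ℝ × ℝ => ∫ s in (0 : ℝ)..p.2, g' p.1 s :=
        intervalIntegral.continuous_parametric_intervalIntegral_of_continuous
          (f := fun (p : ℝ × ℝ) s => g' p.1 s) (by fun_prop) continuous_snd
      exact (ContinuousLinearMap.toSpanSingletonCLE (𝕜 := ℝ) (E := ℂ)).continuous.comp h1)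
    (by
      refine Continuous.continuousAt ?_
      exact (ContinuousLinearMap.toSpanSingletonCLE (𝕜 := ℝ) (E := ℂ)).continuous.comp hg)
  have h2 : HasDerivAt (fun y : ℝ => (y, y)) ((1 : ℝ), (1 : ℝ)) x :=
    (hasDerivAt_id x).prodMk (hasDerivAt_id x)
  have h3 := h.hasFDerivAt.comp_hasDerivAt_of_eq x h2 rfl
  refine h3.congr_deriv ?_
  simp [HasUncurry.uncurry, add_comm]

theorem norm_integral_le_pow_div_factorial {f : ℝ → ℂ} {K u : ℝ} {n : ℕ}
    (hf : ∀ s ∈ uIoc 0 u, ‖f s‖ ≤ K * (|s| ^ n / n.factorial)) (hK : 0 ≤ K) :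
    ‖∫ s in (0 : ℝ)..u, f s‖ ≤ K * (|u| ^ (n + 1) / (n + 1).factorial) := by
  refine (intervalIntegral.norm_integral_le_abs_of_norm_le
    (g := fun s => K * (|s| ^ n / n.factorial))
    ((ae_restrict_iff' measurableSet_uIoc).2 (Eventually.of_forall hf))
    (Continuous.intervalIntegrable (by fun_prop) _ _)).trans ?_
  have := integral_pow_abs_sub_uIoc (a := 0) (b := u) n
  simp only [sub_zero] at this
  rw [intervalIntegral.integral_const_mul, intervalIntegral.integral_div, abs_mul, abs_div,
    intervalIntegral.abs_intervalIntegral_eq, this, abs_of_nonneg hK, Nat.abs_cast,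
    abs_of_nonneg (by positivity), Nat.factorial_succ]
  push_cast
  rw [div_div]

/-! ### Volterra equations in two variables. -/

/-- The Picard iterates of a Volterra equation in two variables. -/
def volterraIterate (k : ℝ → ℝ → ℝ → ℂ) (F : ℝ → ℝ → ℂ) : ℕ → ℝ → ℝ → ℂ
  | 0 => F
  | n + 1 => fun u v => ∫ s in (0 : ℝ)..u, ∫ t in (0 : ℝ)..v, k v s t * volterraIterate k F n s t

theorem continuous_integral_integral {k : ℝ → ℝ → ℝ → ℂ} {X : ℝ → ℝ → ℂ}
    (hk : Continuous fun p : ℝ × ℝ × ℝ => k p.1 p.2.1 p.2.2) (hX : Continuous (uncurry X)) :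
    Continuous fun p : ℝ × ℝ × ℝ => ∫ t in (0 : ℝ)..p.2.2, k p.1 p.2.1 t * X p.2.1 t := by
  refine intervalIntegral.continuous_parametric_intervalIntegral_of_continuous
    (f := fun (p : ℝ × ℝ × ℝ) t => k p.1 p.2.1 t * X p.2.1 t) ?_ (by fun_prop)
  have h1 : Continuous fun p : (ℝ × ℝ × ℝ) × ℝ => k p.1.1 p.1.2.1 p.2 :=
    hk.comp (g := fun p : ℝ × ℝ × ℝ => k p.1 p.2.1 p.2.2)
      (f := fun p : (ℝ × ℝ × ℝ) × ℝ => (p.1.1, p.1.2.1, p.2)) (by fun_prop)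
  have h2 : Continuous fun p : (ℝ × ℝ × ℝ) × ℝ => X p.1.2.1 p.2 :=
    hX.comp (f := fun p : (ℝ × ℝ × ℝ) × ℝ => (p.1.2.1, p.2)) (by fun_prop)
  exact h1.mul h2

theorem continuous_volterraIterate {k : ℝ → ℝ → ℝ → ℂ} {F : ℝ → ℝ → ℂ}
    (hk : Continuous fun p : ℝ × ℝ × ℝ => k p.1 p.2.1 p.2.2) (hF : Continuous (uncurry F))
    (n : ℕ) : Continuous (uncurry (volterraIterate k F n)) := by
  induction n with
  | zero => exact hF
  | succ n ih =>
    have h := continuous_integral_integral hk ih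
    refine intervalIntegral.continuous_parametric_intervalIntegral_of_continuous
      (f := fun (p : ℝ × ℝ) s => ∫ t in (0 : ℝ)..p.2, k p.2 s t * volterraIterate k F n s t)
      ?_ continuous_fst
    exact h.comp (f := fun p : (ℝ × ℝ) × ℝ => (p.1.2, p.2, p.1.2)) (by fun_prop)

/-- Each u-integration raises the power of |u| and produces the factorial; the v-integration is
merely bounded by R. This already makes the Picard series converge. -/
theorem norm_volterraIterate_le {k : ℝ → ℝ → ℝ → ℂ} {F : ℝ → ℝ → ℂ} {R M C : ℝ}
    (hM0 : 0 ≤ M) (hC0 : 0 ≤ C) (hR : 0 ≤ R)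
    (hM : ∀ v s t, |v| ≤ R → |s| ≤ R → |t| ≤ R → ‖k v s t‖ ≤ M)
    (hC : ∀ u v, |u| ≤ R → |v| ≤ R → ‖F u v‖ ≤ C) (n : ℕ) :
    ∀ u v, |u| ≤ R → |v| ≤ R →
      ‖volterraIterate k F n u v‖ ≤ C * (M * R) ^ n * (|u| ^ n / n.factorial) := by
  induction n with
  | zero => intro u v hu hv; simpa [volterraIterate] using hC u v hu hv
  | succ n ih =>
    intro u v hu hv
    have habs : ∀ {b s : ℝ}, |b| ≤ R → s ∈ uIoc 0 b → |s| ≤ R := by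
      intro b s hb hs
      have := abs_sub_left_of_mem_uIcc (uIoc_subset_uIcc hs)
      simp only [sub_zero] at this
      exact this.trans hb
    refine norm_integral_le_pow_div_factorial (fun s hs => ?_) (by positivity)
    refine (intervalIntegral.norm_integral_le_of_norm_le_const
      (C := M * (C * (M * R) ^ n * (|s| ^ n / n.factorial))) (fun t ht => ?_)).trans ?_
    · rw [norm_mul]
      exact mul_le_mul (hM v s t hv (habs hu hs) (habs hv ht)) (ih s t (habs hu hs) (habs hv ht))
        (norm_nonneg _) hM0
    · rw [sub_zero]
      calc _ ≤ M * (C * (M * R) ^ n * (|s| ^ n / n.factorial)) * R := by gcongr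
        _ = _ := by ring

/-- Existence of a continuous solution of a Volterra integral equation in two variables. -/
theorem exists_volterra_solution {k : ℝ → ℝ → ℝ → ℂ} {F : ℝ → ℝ → ℂ}
    (hk : Continuous fun p : ℝ × ℝ × ℝ => k p.1 p.2.1 p.2.2) (hF : Continuous (uncurry F)) :
    ∃ X : ℝ → ℝ → ℂ, Continuous (uncurry X) ∧ ∀ u v,
      X u v = F u v + ∫ s in (0 : ℝ)..u, ∫ t in (0 : ℝ)..v, k v s t * X s t := by
  -- Kernel and data are bounded only on compact sets, so the summable majorant depends on R.
  have key : ∀ R : ℝ, 0 ≤ R → ∃ b : ℕ → ℝ, Summable b ∧ ∀ n u v, |u| ≤ R → |v| ≤ R →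
      ‖volterraIterate k F n u v‖ ≤ b n := by
    intro R hR
    obtain ⟨M, hM⟩ := (isCompact_Icc.prod (isCompact_Icc.prod isCompact_Icc) :
      IsCompact (Icc (-R) R ×ˢ Icc (-R) R ×ˢ Icc (-R) R)).exists_bound_of_continuousOn
        hk.continuousOn
    obtain ⟨C, hC⟩ := (isCompact_Icc.prod isCompact_Icc :
      IsCompact (Icc (-R) R ×ˢ Icc (-R) R)).exists_bound_of_continuousOn hF.continuousOn
    have hM0 : 0 ≤ M := (norm_nonneg _).trans (hM (0, 0, 0) (by simp [hR]))
    have hC0 : 0 ≤ C := (norm_nonneg _).trans (hC (0, 0) (by simp [hR]))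
    refine ⟨fun n => C * ((M * R * R) ^ n / n.factorial),
      (Real.summable_pow_div_factorial _).mul_left C, fun n u v hu hv => ?_⟩
    refine (norm_volterraIterate_le hM0 hC0 hR
      (fun v s t hv hs ht => hM (v, s, t) ⟨abs_le.1 hv, abs_le.1 hs, abs_le.1 ht⟩)
      (fun u v hu hv => hC (u, v) ⟨abs_le.1 hu, abs_le.1 hv⟩) n u v hu hv).trans ?_
    calc _ ≤ C * (M * R) ^ n * (R ^ n / n.factorial) := by gcongr
      _ = C * ((M * R * R) ^ n / n.factorial) := by rw [mul_pow (M * R) R]; ring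
  have hcont := continuous_volterraIterate hk hF
  set X : ℝ → ℝ → ℂ := fun u v => ∑' n, volterraIterate k F n u v with hX
  have hXsum : ∀ u v, HasSum (fun n => volterraIterate k F n u v) (X u v) := by
    intro u v
    obtain ⟨b, hb, hle⟩ := key (max |u| |v|) (by positivity)
    exact (Summable.of_norm_bounded hb
      fun n => hle n u v (le_max_left _ _) (le_max_right _ _)).hasSum
  have hXc : Continuous (uncurry X) := by
    refine continuous_iff_continuousAt.2 fun p => ?_
    obtain ⟨b, hb, hle⟩ := key (max |p.1| |p.2| + 1) (by positivity)
    have hc : ContinuousOn (fun q : ℝ × ℝ => ∑' n, volterraIterate k F n q.1 q.2)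
        {q | |q.1| ≤ max |p.1| |p.2| + 1 ∧ |q.2| ≤ max |p.1| |p.2| + 1} :=
      continuousOn_tsum (fun n => (hcont n).continuousOn) hb
        fun n q hq => hle n q.1 q.2 hq.1 hq.2
    refine hc.continuousAt ?_
    have ho : IsOpen {q : ℝ × ℝ | |q.1| < max |p.1| |p.2| + 1 ∧ |q.2| < max |p.1| |p.2| + 1} :=
      (isOpen_lt (f := fun q : ℝ × ℝ => |q.1|) (by fun_prop) continuous_const).inter
        (isOpen_lt (f := fun q : ℝ × ℝ => |q.2|) (by fun_prop) continuous_const)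
    refine mem_of_superset (ho.mem_nhds ⟨?_, ?_⟩) fun q hq => ⟨hq.1.le, hq.2.le⟩
    · exact lt_of_le_of_lt (le_max_left _ _) (lt_add_one _)
    · exact lt_of_le_of_lt (le_max_right _ _) (lt_add_one _)
  refine ⟨X, hXc, fun u v => ?_⟩
  have hinner : ∀ s, HasSum (fun n => ∫ t in (0 : ℝ)..v, k v s t * volterraIterate k F n s t)
      (∫ t in (0 : ℝ)..v, k v s t * X s t) := by
    intro s
    obtain ⟨b, hb, hle⟩ := key (max |s| |v|) (by positivity)
    have hks : Continuous fun t => k v s t :=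
      hk.comp (f := fun t : ℝ => (v, s, t)) (by fun_prop)
    refine intervalIntegral.hasSum_integral_of_dominated_convergence
      (fun n t => ‖k v s t‖ * b n) (fun n => ?_) (fun n => ?_) ?_ ?_ ?_
    · exact (hks.mul (Continuous.uncurry_left s (hcont n))).aestronglyMeasurable
    · refine Eventually.of_forall fun t ht => ?_
      have := abs_sub_left_of_mem_uIcc (uIoc_subset_uIcc ht)
      simp only [sub_zero] at this
      rw [norm_mul]
      exact mul_le_mul_of_nonneg_left
        (hle n s t (le_max_left _ _) (this.trans (le_max_right _ _))) (norm_nonneg _)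
    · exact Eventually.of_forall fun t _ => hb.mul_left _
    · simp_rw [tsum_mul_left]
      exact (hks.norm.mul continuous_const).intervalIntegrable _ _
    · exact Eventually.of_forall fun t _ => (hXsum s t).mul_left _
  have houter : HasSum (fun n => volterraIterate k F (n + 1) u v)
      (∫ s in (0 : ℝ)..u, ∫ t in (0 : ℝ)..v, k v s t * X s t) := by
    obtain ⟨b, hb, hle⟩ := key (max |u| |v|) (by positivity)
    obtain ⟨M, hM⟩ := (isCompact_uIcc.prod isCompact_uIcc :
      IsCompact (uIcc 0 u ×ˢ uIcc 0 v)).exists_bound_of_continuousOn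
        (f := fun p : ℝ × ℝ => k v p.1 p.2)
        (hk.comp (f := fun p : ℝ × ℝ => (v, p.1, p.2)) (by fun_prop)).continuousOn
    have hM0 : 0 ≤ M := (norm_nonneg _).trans (hM (0, 0) ⟨left_mem_uIcc, left_mem_uIcc⟩)
    refine intervalIntegral.hasSum_integral_of_dominated_convergence
      (fun n _ => M * b n * |v - 0|) (fun n => ?_) (fun n => ?_) ?_ ?_ ?_
    · exact ((continuous_integral_integral hk (hcont n)).comp
        (f := fun s : ℝ => (v, s, v)) (by fun_prop)).aestronglyMeasurable
    · refine Eventually.of_forall fun s hs =>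
        intervalIntegral.norm_integral_le_of_norm_le_const fun t ht => ?_
      have h1 := abs_sub_left_of_mem_uIcc (uIoc_subset_uIcc hs)
      have h2 := abs_sub_left_of_mem_uIcc (uIoc_subset_uIcc ht)
      simp only [sub_zero] at h1 h2
      rw [norm_mul]
      exact mul_le_mul (hM (s, t) ⟨uIoc_subset_uIcc hs, uIoc_subset_uIcc ht⟩)
        (hle n s t (h1.trans (le_max_left _ _)) (h2.trans (le_max_right _ _)))
        (norm_nonneg _) hM0
    · exact Eventually.of_forall fun t _ => (hb.mul_left _).mul_right _
    · exact intervalIntegrable_const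
    · exact Eventually.of_forall fun s _ => hinner s
  have h0 := (hasSum_nat_add_iff' 1).2 (hXsum u v)
  have := houter.unique h0
  rw [this]
  simp [volterraIterate]

/-! ### Uniqueness for the Goursat problem. -/

/-- `H` is continuous on `|u| + |v| ≤ a` and satisfies `∂²H/∂u∂v = q(u+v) H` in the interior. -/
structure SolvesGoursatEquation (a : ℝ) (q : ℝ → ℂ) (H : ℝ → ℝ → ℂ) : Prop where
  continuousOn : ContinuousOn (fun p : ℝ × ℝ => H p.1 p.2) {p | |p.1| + |p.2| ≤ a}
  equation : ∃ Hv : ℝ → ℝ → ℂ, ∀ u v : ℝ, |u| + |v| < a →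
    HasDerivAt (fun v' : ℝ => H u v') (Hv u v) v ∧
    HasDerivAt (fun u' : ℝ => Hv u' v) (q (u + v) * H u v) u

theorem IsGoursatSolution.solves {a : ℝ} {q : ℝ → ℂ} {H : ℝ → ℝ → ℂ}
    (h : IsGoursatSolution a q H) : SolvesGoursatEquation a q H :=
  ⟨h.continuousOn, h.equation⟩

theorem SolvesGoursatEquation.sub {a : ℝ} {q : ℝ → ℂ} {H₁ H₂ : ℝ → ℝ → ℂ}
    (h₁ : SolvesGoursatEquation a q H₁) (h₂ : SolvesGoursatEquation a q H₂) :
    SolvesGoursatEquation a q (fun u v => H₁ u v - H₂ u v) := by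
  refine ⟨h₁.continuousOn.sub h₂.continuousOn, ?_⟩
  obtain ⟨H₁v, e₁⟩ := h₁.equation
  obtain ⟨H₂v, e₂⟩ := h₂.equation
  refine ⟨fun u v => H₁v u v - H₂v u v, fun u v huv => ?_⟩
  refine ⟨(e₁ u v huv).1.sub (e₂ u v huv).1, ?_⟩
  exact ((e₁ u v huv).2.sub (e₂ u v huv).2).congr_deriv (by ring)

theorem add_mem_Icc_of_abs_add_abs_le {a u v : ℝ} (h : |u| + |v| ≤ a) : u + v ∈ Icc (-a) a :=
  abs_le.1 ((abs_add_le u v).trans h)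

theorem abs_le_of_mem_uIcc_zero {s b : ℝ} (hs : s ∈ uIcc 0 b) : |s| ≤ |b| := by
  simpa using abs_sub_left_of_mem_uIcc hs

/-- Inductive bound with zero data on the axes: integrating the equation in u bounds ∂W/∂v, then
integrating in v over a length at most a bounds W. -/
theorem SolvesGoursatEquation.norm_le {a : ℝ} {q : ℝ → ℂ} {W : ℝ → ℝ → ℂ}
    (hq : ContinuousOn q (Icc (-a) a)) (hW : SolvesGoursatEquation a q W)
    (hl : ∀ u ∈ Icc (-a) a, W u 0 = 0) (hr : ∀ v ∈ Icc (-a) a, W 0 v = 0) {M C : ℝ}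
    (hM0 : 0 ≤ M) (hC0 : 0 ≤ C) (hM : ∀ x ∈ Icc (-a) a, ‖q x‖ ≤ M)
    (hC : ∀ u v, |u| + |v| ≤ a → ‖W u v‖ ≤ C) (n : ℕ) :
    ∀ u v, |u| + |v| < a → ‖W u v‖ ≤ C * (M * a) ^ n * (|u| ^ n / n.factorial) := by
  obtain ⟨Wv, he⟩ := hW.equation
  induction n with
  | zero => intro u v huv; simpa using hC u v huv.le
  | succ n ih =>
    have hzero : ∀ v, |v| < a → Wv 0 v = 0 := by
      intro v hv
      have h1 := (he 0 v (by simpa using hv)).1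
      have h2 : HasDerivAt (fun v' : ℝ => W 0 v') 0 v := by
        refine (hasDerivAt_const v (0 : ℂ)).congr_of_eventuallyEq ?_
        filter_upwards [Ioo_mem_nhds (abs_lt.1 hv).1 (abs_lt.1 hv).2] with w hw
        exact hr w ⟨hw.1.le, hw.2.le⟩
      exact h1.unique h2
    have hbound : ∀ u v, |u| + |v| < a →
        ‖Wv u v‖ ≤ M * (C * (M * a) ^ n) * (|u| ^ (n + 1) / (n + 1).factorial) := by
      intro u v huv
      have ha0 : 0 ≤ a := (add_nonneg (abs_nonneg u) (abs_nonneg v)).trans huv.le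
      have hin : ∀ s ∈ uIcc 0 u, |s| + |v| < a := fun s hs =>
        (add_le_add_left (abs_le_of_mem_uIcc_zero hs) _).trans_lt huv
      have hint : Wv u v = ∫ s in (0 : ℝ)..u, q (s + v) * W s v := by
        rw [intervalIntegral.integral_eq_sub_of_hasDerivAt (f := fun s => Wv s v)
          (fun s hs => (he s v (hin s hs)).2), hzero v, sub_zero]
        · exact lt_of_le_of_lt (le_add_of_nonneg_left (abs_nonneg u)) huv
        · refine ContinuousOn.intervalIntegrable (ContinuousOn.mul ?_ ?_)
          · exact hq.comp (f := fun s => s + v) (by fun_prop)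
              fun s hs => add_mem_Icc_of_abs_add_abs_le (hin s hs).le
          · exact hW.continuousOn.comp (f := fun s => (s, v)) (by fun_prop)
              fun s hs => (hin s hs).le
      rw [hint]
      refine norm_integral_le_pow_div_factorial (fun s hs => ?_) (by positivity)
      have hs' := hin s (uIoc_subset_uIcc hs)
      rw [norm_mul, mul_assoc]
      exact mul_le_mul (hM _ (add_mem_Icc_of_abs_add_abs_le hs'.le)) (ih s v hs')
        (norm_nonneg _) hM0
    intro u v huv
    have ha0 : 0 ≤ a := (add_nonneg (abs_nonneg u) (abs_nonneg v)).trans huv.le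
    have hin : ∀ t ∈ uIcc 0 v, |u| + |t| < a := fun t ht =>
      (add_le_add_right (abs_le_of_mem_uIcc_zero ht) _).trans_lt huv
    -- `Wv` is not known to be integrable in v, so the mean value inequality replaces an integral.
    have h := (convex_uIcc (0 : ℝ) v).norm_image_sub_le_of_norm_hasDerivWithin_le
      (f := fun t => W u t) (f' := fun t => Wv u t)
      (fun t ht => (he u t (hin t ht)).1.hasDerivWithinAt)
      (fun t ht => hbound u t (hin t ht)) left_mem_uIcc right_mem_uIcc
    have hu : |u| ≤ a := (le_add_of_nonneg_right (abs_nonneg v)).trans huv.le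
    have hv : |v| ≤ a := (le_add_of_nonneg_left (abs_nonneg u)).trans huv.le
    simp only [hl u (abs_le.1 hu), sub_zero, Real.norm_eq_abs] at h
    refine h.trans ?_
    calc _ ≤ M * (C * (M * a) ^ n) * (|u| ^ (n + 1) / (n + 1).factorial) * a := by gcongr
      _ = _ := by ring

/-- Uniqueness for the Goursat problem. -/
theorem SolvesGoursatEquation.eq_zero {a : ℝ} (ha : 0 < a) {q : ℝ → ℂ} {W : ℝ → ℝ → ℂ}
    (hq : ContinuousOn q (Icc (-a) a)) (hW : SolvesGoursatEquation a q W)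
    (hl : ∀ u ∈ Icc (-a) a, W u 0 = 0) (hr : ∀ v ∈ Icc (-a) a, W 0 v = 0) :
    ∀ u v, |u| + |v| ≤ a → W u v = 0 := by
  obtain ⟨M, hM⟩ := isCompact_Icc.exists_bound_of_continuousOn hq
  have hcl : IsClosed {p : ℝ × ℝ | |p.1| + |p.2| ≤ a} :=
    isClosed_le (f := fun p : ℝ × ℝ => |p.1| + |p.2|) (by fun_prop) continuous_const
  have hcp : IsCompact {p : ℝ × ℝ | |p.1| + |p.2| ≤ a} := by
    refine ((isCompact_Icc (a := -a) (b := a)).prod (isCompact_Icc (a := -a) (b := a)))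
      |>.of_isClosed_subset hcl fun p (hp : |p.1| + |p.2| ≤ a) => ?_
    exact ⟨abs_le.1 ((le_add_of_nonneg_right (abs_nonneg p.2)).trans hp),
      abs_le.1 ((le_add_of_nonneg_left (abs_nonneg p.1)).trans hp)⟩
  obtain ⟨C, hC⟩ := hcp.exists_bound_of_continuousOn hW.continuousOn
  have hM0 : 0 ≤ M := (norm_nonneg _).trans (hM 0 (by constructor <;> linarith))
  have hC0 : 0 ≤ C := (norm_nonneg _).trans (hC (0, 0) (by simp [ha.le]))
  have hopen : ∀ u v, |u| + |v| < a → W u v = 0 := by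
    intro u v huv
    have hle := fun n => hW.norm_le hq hl hr hM0 hC0 hM
      (fun u v huv => hC (u, v) huv) n u v huv
    have ht : Tendsto (fun n : ℕ => C * (M * a) ^ n * (|u| ^ n / n.factorial)) atTop (𝓝 0) := by
      have := (FloorSemiring.tendsto_pow_div_factorial_atTop (M * a * |u|)).const_mul C
      rw [mul_zero] at this
      refine this.congr fun n => ?_
      rw [mul_pow (M * a) |u|]; ring
    exact norm_le_zero_iff.1 (ge_of_tendsto' ht hle)
  intro u v huv
  have hsc : ∀ r ∈ Icc (0 : ℝ) 1, |r * u| + |r * v| = r * (|u| + |v|) := fun r hr => by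
    rw [abs_mul, abs_mul, abs_of_nonneg hr.1]; ring
  have hmem : ∀ r ∈ Icc (0 : ℝ) 1, |r * u| + |r * v| ≤ a := fun r hr => by
    rw [hsc r hr]
    exact (mul_le_of_le_one_left (by positivity) hr.2).trans huv
  -- The equation holds only in the open domain; boundary points are reached by continuity along the
  -- ray from the origin.
  have heq : EqOn (fun r : ℝ => W (r * u) (r * v)) (fun _ => 0) (Ico 0 1) := fun r hr =>
    hopen _ _ (by
      rw [hsc r ⟨hr.1, hr.2.le⟩]
      calc r * (|u| + |v|) ≤ r * a := mul_le_mul_of_nonneg_left huv hr.1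
        _ < a := by nlinarith [hr.2])
  have hc : ContinuousOn (fun r : ℝ => W (r * u) (r * v)) (Icc 0 1) :=
    hW.continuousOn.comp (f := fun r : ℝ => (r * u, r * v)) (by fun_prop) hmem
  have := heq.of_subset_closure hc continuousOn_const Ico_subset_Icc_self
    (by rw [closure_Ico (zero_ne_one' ℝ)]) (right_mem_Icc.2 zero_le_one)
  simpa using this

theorem SolvesGoursatEquation.unique {a : ℝ} (ha : 0 < a) {q : ℝ → ℂ} {H₁ H₂ : ℝ → ℝ → ℂ}
    (hq : ContinuousOn q (Icc (-a) a)) (h₁ : SolvesGoursatEquation a q H₁)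
    (h₂ : SolvesGoursatEquation a q H₂)
    (hl : ∀ u ∈ Icc (-a) a, H₁ u 0 = H₂ u 0) (hr : ∀ v ∈ Icc (-a) a, H₁ 0 v = H₂ 0 v)
    (u v : ℝ) (huv : |u| + |v| ≤ a) : H₁ u v = H₂ u v :=
  sub_eq_zero.1 <| (h₁.sub h₂).eq_zero ha hq (fun u hu => sub_eq_zero.2 (hl u hu))
    (fun v hv => sub_eq_zero.2 (hr v hv)) u v huv

/-! ### Goursat solutions on the whole plane. -/

theorem solvesGoursatEquation_of_continuous {a : ℝ} {q Q : ℝ → ℂ} {H Hv : ℝ → ℝ → ℂ}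
    (hqQ : EqOn Q q (Icc (-a) a)) (hH : Continuous (uncurry H))
    (h1 : ∀ u v, HasDerivAt (fun v' => H u v') (Hv u v) v)
    (h2 : ∀ u v, HasDerivAt (fun u' => Hv u' v) (Q (u + v) * H u v) u) :
    SolvesGoursatEquation a q H := by
  refine ⟨hH.continuousOn, Hv, fun u v huv => ⟨h1 u v, ?_⟩⟩
  rw [← hqQ (add_mem_Icc_of_abs_add_abs_le huv.le)]
  exact h2 u v

theorem continuous_integral_slice_snd {P : ℝ → ℂ} {X : ℝ → ℝ → ℂ} (hP : Continuous P)
    (hX : Continuous (uncurry X)) :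
    Continuous (uncurry fun u v => ∫ t in (0 : ℝ)..v, P (u + t) * X u t) := by
  refine intervalIntegral.continuous_parametric_intervalIntegral_of_continuous
    (f := fun (p : ℝ × ℝ) t => P (p.1 + t) * X p.1 t) ?_ continuous_snd
  exact (by fun_prop : Continuous fun p : (ℝ × ℝ) × ℝ => P (p.1.1 + p.2)).mul
    (hX.comp (f := fun p : (ℝ × ℝ) × ℝ => (p.1.1, p.2)) (by fun_prop))

theorem continuous_integral_slice_fst {P : ℝ → ℂ} {X : ℝ → ℝ → ℂ} (hP : Continuous P)
    (hX : Continuous (uncurry X)) :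
    Continuous (uncurry fun u v => ∫ s in (0 : ℝ)..u, P (s + v) * X s v) := by
  refine intervalIntegral.continuous_parametric_intervalIntegral_of_continuous
    (f := fun (p : ℝ × ℝ) s => P (s + p.2) * X s p.2) ?_ continuous_fst
  exact (by fun_prop : Continuous fun p : (ℝ × ℝ) × ℝ => P (p.2 + p.1.2)).mul
    (hX.comp (f := fun p : (ℝ × ℝ) × ℝ => (p.2, p.1.2)) (by fun_prop))

/-- The integral form of the Goursat problem, on the whole plane. -/
structure IsEntireGoursat (Q : ℝ → ℂ) (H : ℝ → ℝ → ℂ) : Prop where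
  continuous : Continuous (uncurry H)
  eq : ∀ u v, H u v = (1 / 2) * (∫ s in (0 : ℝ)..u, Q s) +
    ∫ s in (0 : ℝ)..u, ∫ t in (0 : ℝ)..v, Q (s + t) * H s t

theorem exists_isEntireGoursat {Q : ℝ → ℂ} (hQ : Continuous Q) : ∃ H, IsEntireGoursat Q H := by
  obtain ⟨X, hX, he⟩ := exists_volterra_solution (k := fun _ s t => Q (s + t))
    (F := fun u _ => (1 / 2) * ∫ s in (0 : ℝ)..u, Q s) (by fun_prop) (by
      refine continuous_const.mul ?_
      exact (intervalIntegral.continuous_primitive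
        (fun a b => hQ.intervalIntegrable a b) 0).comp continuous_fst)
  exact ⟨X, hX, he⟩

namespace IsEntireGoursat

variable {Q : ℝ → ℂ} {H : ℝ → ℝ → ℂ}

theorem hasDerivAt_fst (hQ : Continuous Q) (h : IsEntireGoursat Q H) (u v : ℝ) :
    HasDerivAt (fun u' => H u' v) (Q u / 2 + ∫ t in (0 : ℝ)..v, Q (u + t) * H u t) u := by
  rw [funext fun u' => h.eq u' v]
  have h1 := (hQ.integral_hasStrictDerivAt 0 u).hasDerivAt.const_mul (1 / 2 : ℂ)
  have h2 := ((Continuous.uncurry_right v (continuous_integral_slice_snd hQ h.continuous)).integral_hasStrictDerivAt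
    0 u).hasDerivAt
  exact (h1.add h2).congr_deriv (by ring)

theorem hasDerivAt_snd (hQ : Continuous Q) (h : IsEntireGoursat Q H) (u v : ℝ) :
    HasDerivAt (fun v' => H u v') (∫ s in (0 : ℝ)..u, Q (s + v) * H s v) v := by
  rw [funext fun v' => h.eq u v']
  refine HasDerivAt.const_add _ ?_
  have hc := h.continuous
  refine hasDerivAt_integral_param (g := fun v s => ∫ t in (0 : ℝ)..v, Q (s + t) * H s t)
    (g' := fun v s => Q (s + v) * H s v) ?_ ?_ ?_ u v
  · exact (continuous_integral_slice_snd hQ h.continuous).comp continuous_swap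
  · exact (by fun_prop : Continuous fun p : ℝ × ℝ => Q (p.2 + p.1)).mul (hc.comp continuous_swap)
  · intro v s
    exact (Continuous.integral_hasStrictDerivAt
      ((by fun_prop : Continuous fun t => Q (s + t)).mul (Continuous.uncurry_left s hc))
      0 v).hasDerivAt

theorem hasDerivAt_snd_fst (hQ : Continuous Q) (h : IsEntireGoursat Q H) (u v : ℝ) :
    HasDerivAt (fun u' => ∫ s in (0 : ℝ)..u', Q (s + v) * H s v) (Q (u + v) * H u v) u :=
  (Continuous.integral_hasStrictDerivAt
      ((by fun_prop : Continuous fun s => Q (s + v)).mul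
        (Continuous.uncurry_right v h.continuous)) 0 u).hasDerivAt

theorem apply_zero_left (h : IsEntireGoursat Q H) (v : ℝ) : H 0 v = 0 := by simp [h.eq 0 v]

theorem apply_zero_right (h : IsEntireGoursat Q H) (u : ℝ) :
    H u 0 = (1 / 2) * ∫ s in (0 : ℝ)..u, Q s := by simp [h.eq u 0]

theorem isGoursatSolution (hQ : Continuous Q) (h : IsEntireGoursat Q H) {a : ℝ} {q : ℝ → ℂ}
    (hqQ : EqOn Q q (Icc (-a) a)) : IsGoursatSolution a q H := by
  have hs := solvesGoursatEquation_of_continuous hqQ h.continuous (h.hasDerivAt_snd hQ)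
    (h.hasDerivAt_snd_fst hQ)
  refine ⟨hs.continuousOn, hs.equation, fun u hu => ?_, fun v _ => h.apply_zero_left v⟩
  rw [h.apply_zero_right]
  congr 1
  refine intervalIntegral.integral_congr fun s hs => hqQ ?_
  exact abs_le.1 ((abs_le_of_mem_uIcc_zero hs).trans (abs_le.2 hu))

/-- `goursatSolution` is a choice; uniqueness replaces it on the domain by any explicitly
constructed entire solution for an extension of q. -/
theorem goursatSolution_eq (hQ : Continuous Q) (h : IsEntireGoursat Q H) {a : ℝ} (ha : 0 < a)
    {q : ℝ → ℂ} (hqQ : EqOn Q q (Icc (-a) a)) (u v : ℝ) (huv : |u| + |v| ≤ a) :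
    goursatSolution a q u v = H u v := by
  have hH := h.isGoursatSolution hQ hqQ
  have hex : ∃ H, IsGoursatSolution a q H := ⟨H, hH⟩
  have hg : IsGoursatSolution a q (goursatSolution a q) := by
    unfold goursatSolution
    rw [dif_pos hex]
    exact hex.choose_spec
  refine hg.solves.unique ha (hQ.continuousOn.congr fun x hx => (hqQ hx).symm) hH.solves
    (fun u hu => ?_) (fun v hv => ?_) u v huv
  · rw [hg.left_data u hu, hH.left_data u hu]
  · rw [hg.right_data v hv, hH.right_data v hv]

end IsEntireGoursat

/-! ### The parametrized kernel in characteristic coordinates. -/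

theorem abs_half_add_abs_half_le {a x s : ℝ} (hx : x ∈ Icc (-a) a) (hs : s ∈ Icc (-a) a) :
    |(x + s) / 2| + |(x - s) / 2| ≤ a := by
  obtain ⟨hx1, hx2⟩ := hx
  obtain ⟨hs1, hs2⟩ := hs
  rcases abs_cases ((x + s) / 2) with h1 | h1 <;> rcases abs_cases ((x - s) / 2) with h2 | h2 <;>
    linarith [h1.1, h2.1]

/-- The integral `∫ₜˣ (K(x,s) - K(x,-s)) ds` in the variables `u = (x+t)/2`, `v = (x-t)/2`. -/
def oddPrimitive (H : ℝ → ℝ → ℂ) (u v : ℝ) : ℂ :=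
  2 * ∫ τ in (0 : ℝ)..v, (H (u + τ) (v - τ) - H (v - τ) (u + τ))

/-- The kernel `K(x,t;c)` in the variables `u = (x+t)/2`, `v = (x-t)/2`. -/
def charKernel (H : ℝ → ℝ → ℂ) (c : ℂ) (u v : ℝ) : ℂ :=
  c / 2 + H u v + (c / 2) * oddPrimitive H u v

/-- The partial derivative of `oddPrimitive` in the second variable. -/
def oddPrimitiveDeriv (Q : ℝ → ℂ) (H : ℝ → ℝ → ℂ) (u v : ℝ) : ℂ :=
  2 * ((H (u + v) 0 - H 0 (u + v)) + ∫ τ in (0 : ℝ)..v,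
    ((∫ s in (0 : ℝ)..(u + τ), Q (s + (v - τ)) * H s (v - τ)) -
      (Q (v - τ) / 2 + ∫ t in (0 : ℝ)..(u + τ), Q ((v - τ) + t) * H (v - τ) t)))

theorem continuous_oddPrimitive {H : ℝ → ℝ → ℂ} (hH : Continuous (uncurry H)) :
    Continuous (uncurry (oddPrimitive H)) := by
  refine continuous_const.mul
    (intervalIntegral.continuous_parametric_intervalIntegral_of_continuous
    (f := fun (p : ℝ × ℝ) τ => H (p.1 + τ) (p.2 - τ) - H (p.2 - τ) (p.1 + τ)) ?_ continuous_snd)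
  exact (hH.comp (f := fun p : (ℝ × ℝ) × ℝ => (p.1.1 + p.2, p.1.2 - p.2)) (by fun_prop)).sub
    (hH.comp (f := fun p : (ℝ × ℝ) × ℝ => (p.1.2 - p.2, p.1.1 + p.2)) (by fun_prop))

theorem oddPrimitive_zero_right (H : ℝ → ℝ → ℂ) (u : ℝ) : oddPrimitive H u 0 = 0 := by
  simp [oddPrimitive]

/-- Here t = -x, and the integral of an odd function over a symmetric interval vanishes. -/
theorem oddPrimitive_zero_left {H : ℝ → ℝ → ℂ} (hH : Continuous (uncurry H)) (v : ℝ) :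
    oddPrimitive H 0 v = 0 := by
  have h := intervalIntegral.integral_comp_sub_left (a := 0) (b := v)
    (fun τ => H (v - τ) τ) v
  simp only [sub_sub_cancel, sub_self, sub_zero] at h
  unfold oddPrimitive
  simp only [zero_add]
  rw [intervalIntegral.integral_sub, h, sub_self, mul_zero]
  · exact (hH.comp (f := fun τ : ℝ => (τ, v - τ)) (by fun_prop)).intervalIntegrable _ _
  · exact (hH.comp (f := fun τ : ℝ => (v - τ, τ)) (by fun_prop)).intervalIntegrable _ _

namespace IsEntireGoursat

variable {Q : ℝ → ℂ} {H : ℝ → ℝ → ℂ}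

theorem hasDerivAt_oddPrimitive (hQ : Continuous Q) (h : IsEntireGoursat Q H) (u v : ℝ) :
    HasDerivAt (fun v' => oddPrimitive H u v') (oddPrimitiveDeriv Q H u v) v := by
  have hc := h.continuous
  have h1 := hasDerivAt_integral_param_self
    (g := fun v τ => H (u + τ) (v - τ) - H (v - τ) (u + τ))
    (g' := fun v τ => (∫ s in (0 : ℝ)..(u + τ), Q (s + (v - τ)) * H s (v - τ)) -
      (Q (v - τ) / 2 + ∫ t in (0 : ℝ)..(u + τ), Q ((v - τ) + t) * H (v - τ) t)) ?_ ?_ ?_ v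
  · refine (h1.const_mul (2 : ℂ)).congr_deriv ?_
    simp only [oddPrimitiveDeriv, sub_self]
  · exact (hc.comp (f := fun p : ℝ × ℝ => (u + p.2, p.1 - p.2)) (by fun_prop)).sub
      (hc.comp (f := fun p : ℝ × ℝ => (p.1 - p.2, u + p.2)) (by fun_prop))
  · refine ((continuous_integral_slice_fst hQ hc).comp
      (f := fun p : ℝ × ℝ => (u + p.2, p.1 - p.2)) (by fun_prop)).sub (Continuous.add ?_ ?_)
    · exact (by fun_prop : Continuous fun p : ℝ × ℝ => Q (p.1 - p.2) / 2)
    · exact (continuous_integral_slice_snd hQ hc).comp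
        (f := fun p : ℝ × ℝ => (p.1 - p.2, u + p.2)) (by fun_prop)
  · intro x τ
    exact ((h.hasDerivAt_snd hQ (u + τ) (x - τ)).comp_sub_const x τ).sub
      ((h.hasDerivAt_fst hQ (x - τ) (u + τ)).comp_sub_const x τ)

/-- Along the integration path the arguments u+τ and v-τ have constant sum u+v, so Q(u+v) comes out
of the integral. The term Q(v-τ)/2 does not involve u, so Q is never differentiated. -/
theorem hasDerivAt_oddPrimitiveDeriv (hQ : Continuous Q) (h : IsEntireGoursat Q H) (u v : ℝ) :
    HasDerivAt (fun u' => oddPrimitiveDeriv Q H u' v)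
      (Q (u + v) * (1 + oddPrimitive H u v)) u := by
  have hc := h.continuous
  have h1 := hasDerivAt_integral_param
    (g := fun u τ => (∫ s in (0 : ℝ)..(u + τ), Q (s + (v - τ)) * H s (v - τ)) -
      (Q (v - τ) / 2 + ∫ t in (0 : ℝ)..(u + τ), Q ((v - τ) + t) * H (v - τ) t))
    (g' := fun u τ => Q (u + v) * (H (u + τ) (v - τ) - H (v - τ) (u + τ))) ?_ ?_ ?_ v u
  · have h2 : HasDerivAt (fun u' => H (u' + v) 0 - H 0 (u' + v)) (Q (u + v) / 2) u := by
      have h3 := (h.hasDerivAt_fst hQ (u + v) 0).comp_add_const u v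
      simpa [h.apply_zero_left] using h3
    refine ((h2.add h1).const_mul (2 : ℂ)).congr_deriv ?_
    rw [intervalIntegral.integral_const_mul, oddPrimitive]
    ring
  · refine ((continuous_integral_slice_fst hQ hc).comp
      (f := fun p : ℝ × ℝ => (p.1 + p.2, v - p.2)) (by fun_prop)).sub (Continuous.add ?_ ?_)
    · exact (by fun_prop : Continuous fun p : ℝ × ℝ => Q (v - p.2) / 2)
    · exact (continuous_integral_slice_snd hQ hc).comp
        (f := fun p : ℝ × ℝ => (v - p.2, p.1 + p.2)) (by fun_prop)
  · exact (by fun_prop : Continuous fun p : ℝ × ℝ => Q (p.1 + v)).mul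
      ((hc.comp (f := fun p : ℝ × ℝ => (p.1 + p.2, v - p.2)) (by fun_prop)).sub
      (hc.comp (f := fun p : ℝ × ℝ => (v - p.2, p.1 + p.2)) (by fun_prop)))
  · intro x τ
    have h3 := (h.hasDerivAt_snd_fst hQ (x + τ) (v - τ)).comp_add_const x τ
    have h4 := ((Continuous.integral_hasStrictDerivAt
      ((by fun_prop : Continuous fun t => Q ((v - τ) + t)).mul
        (Continuous.uncurry_left (v - τ) hc)) 0 (x + τ)).hasDerivAt).comp_add_const x τ
    refine (h3.sub (h4.const_add (Q (v - τ) / 2))).congr_deriv ?_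
    simp only [Pi.mul_apply]
    rw [show x + τ + (v - τ) = x + v by ring, show v - τ + (x + τ) = x + v by ring]
    ring

/-- The odd primitive O satisfies O_uv = Q(u+v)(1+O), and the constant c/2 in the kernel absorbs the
extra 1. -/
theorem solves_charKernel (hQ : Continuous Q) (h : IsEntireGoursat Q H) (c : ℂ) (a : ℝ) :
    SolvesGoursatEquation a Q (charKernel H c) := by
  refine solvesGoursatEquation_of_continuous (Q := Q) (fun _ _ => rfl)
    (Hv := fun u v => (∫ s in (0 : ℝ)..u, Q (s + v) * H s v) +
      (c / 2) * oddPrimitiveDeriv Q H u v) ?_ (fun u v => ?_) (fun u v => ?_)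
  · exact (continuous_const.add h.continuous).add
      (continuous_const.mul (continuous_oddPrimitive h.continuous))
  · exact ((h.hasDerivAt_snd hQ u v).const_add (c / 2)).add
      ((h.hasDerivAt_oddPrimitive hQ u v).const_mul (c / 2))
  · refine ((h.hasDerivAt_snd_fst hQ u v).add
      ((h.hasDerivAt_oddPrimitiveDeriv hQ u v).const_mul (c / 2))).congr_deriv ?_
    simp only [charKernel]
    ring

theorem paramKernel_eq (hQ : Continuous Q) (h : IsEntireGoursat Q H) {a : ℝ} (ha : 0 < a)
    {q : ℝ → ℂ} (hqQ : EqOn Q q (Icc (-a) a)) (c : ℂ) {x t : ℝ} (hx : x ∈ Icc (-a) a)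
    (ht : t ∈ Icc (-a) a) :
    paramKernel a q c x t = charKernel H c ((x + t) / 2) ((x - t) / 2) := by
  have hk : ∀ s ∈ Icc (-a) a, kernel a q x s = H ((x + s) / 2) ((x - s) / 2) := fun s hs =>
    h.goursatSolution_eq hQ ha hqQ _ _ (abs_half_add_abs_half_le hx hs)
  unfold paramKernel charKernel
  rw [hk t ht]
  congr 2
  have h1 : ∫ s in t..x, (kernel a q x s - kernel a q x (-s)) =
      ∫ s in t..x, (H ((x + s) / 2) ((x - s) / 2) - H ((x - s) / 2) ((x + s) / 2)) := by
    refine intervalIntegral.integral_congr fun s hs => ?_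
    have hs' : s ∈ Icc (-a) a := uIcc_subset_Icc ht hx hs
    have hs'' : -s ∈ Icc (-a) a := ⟨by linarith [hs'.2], by linarith [hs'.1]⟩
    simp only [hk s hs', hk (-s) hs'', sub_neg_eq_add, ← sub_eq_add_neg]
  -- Substituting s = t + 2τ moves (u,v) to (u+τ, v-τ), and s ↦ -s swaps the two coordinates.
  have h2 := intervalIntegral.smul_integral_comp_add_mul (a := 0) (b := (x - t) / 2)
    (fun s => H ((x + s) / 2) ((x - s) / 2) - H ((x - s) / 2) ((x + s) / 2)) 2 t
  rw [mul_zero, add_zero, mul_div_cancel₀ _ (two_ne_zero' ℝ), add_sub_cancel] at h2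
  rw [h1, ← h2, oddPrimitive, Complex.real_smul, Complex.ofReal_ofNat]
  congr 1
  refine intervalIntegral.integral_congr fun τ _ => ?_
  rw [show (x + (t + 2 * τ)) / 2 = (x + t) / 2 + τ by ring,
    show (x - (t + 2 * τ)) / 2 = (x - t) / 2 - τ by ring]

end IsEntireGoursat

/-! ### The first order system and factorization of the kernel. -/

/-- The Goursat problem for the first order system `S_u = φ(u+v) D`, `D_v = φ(u+v) S` with
`S(0,v) = 0`, `D(u,0) = φ(u)`, in integral form. -/
structure IsDiracGoursat (φ : ℝ → ℂ) (S D : ℝ → ℝ → ℂ) : Prop where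
  continuous_fst : Continuous (uncurry S)
  continuous_snd : Continuous (uncurry D)
  eq_fst : ∀ u v, S u v = ∫ s in (0 : ℝ)..u, φ (s + v) * D s v
  eq_snd : ∀ u v, D u v = φ u + ∫ t in (0 : ℝ)..v, φ (u + t) * S u t

theorem exists_isDiracGoursat {φ : ℝ → ℂ} (hφ : Continuous φ) :
    ∃ S D, IsDiracGoursat φ S D := by
  have hF : Continuous (uncurry fun u v => ∫ s in (0 : ℝ)..u, φ (s + v) * φ s) :=
    continuous_integral_slice_fst hφ (X := fun s _ => φ s) (by fun_prop)
  -- Eliminating D leaves a Volterra equation for S alone, whose kernel depends on the endpoint v.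
  obtain ⟨S, hS, he⟩ := exists_volterra_solution
    (k := fun v s t => φ (s + v) * φ (s + t)) (by fun_prop) hF
  have hsl := continuous_integral_slice_snd hφ hS
  refine ⟨S, fun u v => φ u + ∫ t in (0 : ℝ)..v, φ (u + t) * S u t, hS, ?_, fun u v => ?_,
    fun u v => rfl⟩
  · exact (hφ.comp continuous_fst).add hsl
  · rw [he u v, ← intervalIntegral.integral_add]
    · refine intervalIntegral.integral_congr fun s _ => ?_
      simp only [mul_add, mul_assoc, intervalIntegral.integral_const_mul]
    · exact Continuous.intervalIntegrable (by fun_prop) _ _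
    · simp only [mul_assoc, intervalIntegral.integral_const_mul]
      exact ((by fun_prop : Continuous fun s => φ (s + v)).mul
        (Continuous.uncurry_right v hsl)).intervalIntegrable _ _

namespace IsDiracGoursat

variable {φ p : ℝ → ℂ} {S D : ℝ → ℝ → ℂ}

theorem neg (h : IsDiracGoursat φ S D) :
    IsDiracGoursat (fun x => -φ x) S (fun u v => -D u v) := by
  refine ⟨h.continuous_fst, h.continuous_snd.neg, fun u v => ?_, fun u v => ?_⟩
  · rw [h.eq_fst]
    exact intervalIntegral.integral_congr fun s _ => by simp
  · rw [h.eq_snd, neg_add, ← intervalIntegral.integral_neg]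
    congr 1
    exact intervalIntegral.integral_congr fun s _ => by simp

theorem hasDerivAt_fst (hφ : Continuous φ) (h : IsDiracGoursat φ S D) (u v : ℝ) :
    HasDerivAt (fun u' => S u' v) (φ (u + v) * D u v) u := by
  rw [funext fun u' => h.eq_fst u' v]
  exact (Continuous.integral_hasStrictDerivAt
    ((by fun_prop : Continuous fun s => φ (s + v)).mul
      (Continuous.uncurry_right v h.continuous_snd)) 0 u).hasDerivAt

theorem hasDerivAt_snd (hφ : Continuous φ) (h : IsDiracGoursat φ S D) (u v : ℝ) :
    HasDerivAt (fun v' => D u v') (φ (u + v) * S u v) v := by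
  rw [funext fun v' => h.eq_snd u v']
  exact (Continuous.integral_hasStrictDerivAt
    ((by fun_prop : Continuous fun s => φ (u + s)).mul
      (Continuous.uncurry_left u h.continuous_fst)) 0 v).hasDerivAt.const_add _

theorem apply_zero_fst (h : IsDiracGoursat φ S D) (v : ℝ) : S 0 v = 0 := by simp [h.eq_fst 0 v]

theorem apply_zero_snd (h : IsDiracGoursat φ S D) (u : ℝ) : D u 0 = φ u := by simp [h.eq_snd u 0]

/-- Differentiating S + D in v and then in u gives φ'D + φ²S + φ'S + φ²D = (φ² + φ')(S + D). -/
theorem solves (hφ : ∀ x, HasDerivAt φ (p x) x) (hp : Continuous p) (h : IsDiracGoursat φ S D)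
    (a : ℝ) :
    SolvesGoursatEquation a (fun x => φ x ^ 2 + p x) (fun u v => (S u v + D u v) / 2) := by
  have hφc : Continuous φ := continuous_iff_continuousAt.2 fun x => (hφ x).continuousAt
  have hSc := h.continuous_fst
  have hDc := h.continuous_snd
  refine solvesGoursatEquation_of_continuous (fun _ _ => rfl)
    (Hv := fun u v => ((∫ s in (0 : ℝ)..u, (p (s + v) * D s v + φ (s + v) * (φ (s + v) * S s v))) +
      φ (u + v) * S u v) / 2) ((hSc.add hDc).div_const 2) (fun u v => ?_) (fun u v => ?_)
  · have h1 : HasDerivAt (fun v' => S u v')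
        (∫ s in (0 : ℝ)..u, (p (s + v) * D s v + φ (s + v) * (φ (s + v) * S s v))) v := by
      rw [funext fun v' => h.eq_fst u v']
      refine hasDerivAt_integral_param (g := fun v s => φ (s + v) * D s v)
        (g' := fun v s => p (s + v) * D s v + φ (s + v) * (φ (s + v) * S s v)) ?_ ?_ ?_ u v
      · exact (by fun_prop : Continuous fun x : ℝ × ℝ => φ (x.2 + x.1)).mul
          (hDc.comp continuous_swap)
      · have h2 : Continuous fun x : ℝ × ℝ => φ (x.2 + x.1) := by fun_prop
        exact ((by fun_prop : Continuous fun x : ℝ × ℝ => p (x.2 + x.1)).mul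
          (hDc.comp continuous_swap)).add (h2.mul (h2.mul (hSc.comp continuous_swap)))
      · intro v s
        exact ((hφ (s + v)).comp_const_add s v).mul (h.hasDerivAt_snd hφc s v)
    exact (h1.add (h.hasDerivAt_snd hφc u v)).div_const 2
  · have h1 : HasDerivAt (fun u' => ∫ s in (0 : ℝ)..u',
        (p (s + v) * D s v + φ (s + v) * (φ (s + v) * S s v)))
        (p (u + v) * D u v + φ (u + v) * (φ (u + v) * S u v)) u := by
      refine (Continuous.integral_hasStrictDerivAt ?_ 0 u).hasDerivAt
      have h2 : Continuous fun s => φ (s + v) := by fun_prop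
      exact ((by fun_prop : Continuous fun s => p (s + v)).mul
        (Continuous.uncurry_right v hDc)).add
          (h2.mul (h2.mul (Continuous.uncurry_right v hSc)))
    have h3 := ((hφ (u + v)).comp_add_const u v).mul (h.hasDerivAt_fst hφc u v)
    refine ((h1.add h3).div_const 2).congr_deriv ?_
    ring

/-- Both sides equal φ(0)/2 + ½∫₀ᵘ(φ² + φ') on v = 0 and φ(0)/2 on u = 0. The choice c = φ(0) is
forced by the second value. -/
theorem paramKernel_eq (hφ : ∀ x, HasDerivAt φ (p x) x) (hp : Continuous p)
    (h : IsDiracGoursat φ S D) {a : ℝ} (ha : 0 < a) {q : ℝ → ℂ}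
    (hq : EqOn (fun x => φ x ^ 2 + p x) q (Icc (-a) a)) {x t : ℝ} (hx : x ∈ Icc (-a) a)
    (ht : t ∈ Icc (-a) a) :
    paramKernel a q (φ 0) x t =
      (S ((x + t) / 2) ((x - t) / 2) + D ((x + t) / 2) ((x - t) / 2)) / 2 := by
  have hφc : Continuous φ := continuous_iff_continuousAt.2 fun x => (hφ x).continuousAt
  have hQ : Continuous fun x => φ x ^ 2 + p x := by fun_prop
  obtain ⟨H, hH⟩ := exists_isEntireGoursat hQ
  rw [hH.paramKernel_eq hQ ha hq (φ 0) hx ht]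
  refine (hH.solves_charKernel hQ (φ 0) a).unique ha hQ.continuousOn (h.solves hφ hp a)
    (fun u _ => ?_) (fun v _ => ?_) _ _ (abs_half_add_abs_half_le hx ht)
  · have h1 : ∫ s in (0 : ℝ)..u, p s = φ u - φ 0 :=
      intervalIntegral.integral_eq_sub_of_hasDerivAt (fun s _ => hφ s) (hp.intervalIntegrable _ _)
    have h2 : S u 0 = ∫ s in (0 : ℝ)..u, φ s ^ 2 := by
      rw [h.eq_fst]
      refine intervalIntegral.integral_congr fun s _ => ?_
      simp only [add_zero, h.apply_zero_snd, sq]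
    rw [charKernel, oddPrimitive_zero_right, hH.apply_zero_right, intervalIntegral.integral_add
      ((by fun_prop : Continuous fun s => φ s ^ 2).intervalIntegrable _ _)
      (hp.intervalIntegrable _ _), h1, h2, h.apply_zero_snd]
    ring
  · rw [charKernel, oddPrimitive_zero_left hH.continuous, hH.apply_zero_left, h.apply_zero_fst,
      h.eq_snd]
    simp [h.apply_zero_fst]

end IsDiracGoursat

/-! ### The Volterra operators and the intertwining relation. -/

/-- Extend w' by constants beyond the endpoints and integrate. -/
theorem exists_hasDerivAt_extension {a b : ℝ} (hab : a ≤ b) {w w' : ℝ → ℂ}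
    (hw : ContinuousOn w (Icc a b)) (hd : ∀ x ∈ Ioo a b, HasDerivAt w (w' x) x)
    (hw' : ContinuousOn w' (Icc a b)) :
    ∃ W W' : ℝ → ℂ, (∀ x, HasDerivAt W (W' x) x) ∧ Continuous W' ∧
      EqOn W w (Icc a b) ∧ EqOn W' w' (Icc a b) := by
  set W' : ℝ → ℂ := IccExtend hab ((Icc a b).domRestrict w') with hW'
  have hc : Continuous W' := (continuousOn_iff_continuous_domRestrict.1 hw').Icc_extend'
  have he : EqOn W' w' (Icc a b) := fun x hx => by
    rw [hW', IccExtend_of_mem _ _ hx]; rfl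
  refine ⟨fun x => w a + ∫ s in a..x, W' s, W', fun x => ?_, hc, fun x hx => ?_, he⟩
  · exact (hc.integral_hasStrictDerivAt a x).hasDerivAt.const_add _
  · have hsub : Icc a x ⊆ Icc a b := Icc_subset_Icc_right hx.2
    have : ∫ s in a..x, W' s = w x - w a := by
      refine intervalIntegral.integral_eq_sub_of_hasDerivAt_of_le hx.1 (hw.mono hsub)
        (fun s hs => ?_) (hc.intervalIntegrable _ _)
      have hs' : s ∈ Ioo a b := ⟨hs.1, hs.2.trans_le hx.2⟩
      rw [he (Ioo_subset_Icc_self hs')]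
      exact hd s hs'
    simp only [this, add_sub_cancel]

/-- The part of the Volterra operator coming from the component `S` of the kernel. -/
def fstIntegral (S : ℝ → ℝ → ℂ) (U : ℝ → ℂ) (x : ℝ) : ℂ :=
  ∫ τ in (0 : ℝ)..x, S (x - τ) τ * U (x - 2 * τ)

/-- The part of the Volterra operator coming from the component `D` of the kernel. -/
def sndIntegral (D : ℝ → ℝ → ℂ) (U : ℝ → ℂ) (x : ℝ) : ℂ :=
  ∫ τ in (0 : ℝ)..x, D τ (x - τ) * U (2 * τ - x)

theorem fstIntegral_eq (S : ℝ → ℝ → ℂ) (U : ℝ → ℂ) (x : ℝ) :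
    fstIntegral S U x = ∫ τ in (0 : ℝ)..x, S τ (x - τ) * U (2 * τ - x) := by
  have h := intervalIntegral.integral_comp_sub_left (a := 0) (b := x)
    (fun τ => S τ (x - τ) * U (2 * τ - x)) x
  rw [sub_self, sub_zero] at h
  rw [← h]
  refine intervalIntegral.integral_congr fun τ _ => ?_
  rw [sub_sub_cancel, show 2 * (x - τ) - x = x - 2 * τ by ring]

theorem sndIntegral_neg (D : ℝ → ℝ → ℂ) (U : ℝ → ℂ) (x : ℝ) :
    sndIntegral (fun u v => -D u v) U x = -sndIntegral D U x := by
  simp [sndIntegral]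

namespace IsDiracGoursat

variable {φ p : ℝ → ℂ} {S D : ℝ → ℝ → ℂ} {U U' : ℝ → ℂ}

/-- With t = x - 2τ, the variable x enters S only through its first argument, so only the known S_u
occurs. The boundary term contains S(0,x) = 0. -/
theorem hasDerivAt_fstIntegral (hφ : Continuous φ) (h : IsDiracGoursat φ S D)
    (hU : ∀ x, HasDerivAt U (U' x) x) (hU' : Continuous U') (x : ℝ) :
    HasDerivAt (fstIntegral S U) (φ x * sndIntegral D U x + fstIntegral S U' x) x := by
  have hUc : Continuous U := continuous_iff_continuousAt.2 fun x => (hU x).continuousAt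
  have hS : Continuous fun y : ℝ × ℝ => S (y.1 - y.2) y.2 := h.continuous_fst.comp
    (f := fun y : ℝ × ℝ => (y.1 - y.2, y.2)) (by fun_prop)
  have hD : Continuous fun y : ℝ × ℝ => D (y.1 - y.2) y.2 := h.continuous_snd.comp
    (f := fun y : ℝ × ℝ => (y.1 - y.2, y.2)) (by fun_prop)
  have hUU : Continuous fun y : ℝ × ℝ => U (y.1 - 2 * y.2) := by fun_prop
  have hUU' : Continuous fun y : ℝ × ℝ => U' (y.1 - 2 * y.2) := by fun_prop
  have h1 := hasDerivAt_integral_param_self (g := fun x τ => S (x - τ) τ * U (x - 2 * τ))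
    (g' := fun x τ => φ x * (D (x - τ) τ * U (x - 2 * τ)) + S (x - τ) τ * U' (x - 2 * τ))
    (hS.mul hUU)
    ((hφ.comp _root_.continuous_fst).mul (hD.mul hUU) |>.add (hS.mul hUU')) (fun x τ => ?_) x
  · refine h1.congr_deriv ?_
    have h2 := fstIntegral_eq D U x
    rw [fstIntegral] at h2
    rw [sub_self, h.apply_zero_fst, zero_mul, zero_add, intervalIntegral.integral_add,
      intervalIntegral.integral_const_mul, h2, sndIntegral, fstIntegral]
    · exact (continuous_const.mul ((hD.mul hUU).comp
        (f := fun τ : ℝ => (x, τ)) (by fun_prop))).intervalIntegrable _ _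
    · exact ((hS.mul hUU').comp (f := fun τ : ℝ => (x, τ)) (by fun_prop)).intervalIntegrable _ _
  · have h3 := ((h.hasDerivAt_fst hφ (x - τ) τ).comp_sub_const x τ).mul
      ((hU (x - 2 * τ)).comp_sub_const x (2 * τ))
    refine h3.congr_deriv ?_
    rw [sub_add_cancel]
    ring

/-- With t = 2τ - x, the variable x enters D only through its second argument, so only D_v occurs.
The boundary term is φ(x)U(x), and t decreasing in x causes the minus sign before U'. -/
theorem hasDerivAt_sndIntegral (hφ : Continuous φ) (h : IsDiracGoursat φ S D)
    (hU : ∀ x, HasDerivAt U (U' x) x) (hU' : Continuous U') (x : ℝ) :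
    HasDerivAt (sndIntegral D U)
      (φ x * U x + φ x * fstIntegral S U x - sndIntegral D U' x) x := by
  have hUc : Continuous U := continuous_iff_continuousAt.2 fun x => (hU x).continuousAt
  have hS : Continuous fun y : ℝ × ℝ => S y.2 (y.1 - y.2) := h.continuous_fst.comp
    (f := fun y : ℝ × ℝ => (y.2, y.1 - y.2)) (by fun_prop)
  have hD : Continuous fun y : ℝ × ℝ => D y.2 (y.1 - y.2) := h.continuous_snd.comp
    (f := fun y : ℝ × ℝ => (y.2, y.1 - y.2)) (by fun_prop)
  have hUU : Continuous fun y : ℝ × ℝ => U (2 * y.2 - y.1) := by fun_prop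
  have hUU' : Continuous fun y : ℝ × ℝ => U' (2 * y.2 - y.1) := by fun_prop
  have h1 := hasDerivAt_integral_param_self (g := fun x τ => D τ (x - τ) * U (2 * τ - x))
    (g' := fun x τ => φ x * (S τ (x - τ) * U (2 * τ - x)) - D τ (x - τ) * U' (2 * τ - x))
    (hD.mul hUU)
    ((hφ.comp _root_.continuous_fst).mul (hS.mul hUU) |>.sub (hD.mul hUU')) (fun x τ => ?_) x
  · refine h1.congr_deriv ?_
    rw [sub_self, h.apply_zero_snd, intervalIntegral.integral_sub,
      intervalIntegral.integral_const_mul, ← fstIntegral_eq, show 2 * x - x = x by ring,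
      sndIntegral]
    · ring
    · exact (continuous_const.mul ((hS.mul hUU).comp
        (f := fun τ : ℝ => (x, τ)) (by fun_prop))).intervalIntegrable _ _
    · exact ((hD.mul hUU').comp (f := fun τ : ℝ => (x, τ)) (by fun_prop)).intervalIntegrable _ _
  · have h3 := ((h.hasDerivAt_snd hφ τ (x - τ)).comp_sub_const x τ).mul
      ((hU (2 * τ - x)).comp_const_sub (2 * τ) x)
    refine h3.congr_deriv ?_
    rw [add_sub_cancel]
    ring

/-- The factor 2 from dt = ±2dτ cancels the ½ in the kernel (S+D)/2. -/
theorem transmutation_eq (hφ : ∀ x, HasDerivAt φ (p x) x) (hp : Continuous p)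
    (h : IsDiracGoursat φ S D) {a : ℝ} (ha : 0 < a) {q : ℝ → ℂ}
    (hq : EqOn (fun x => φ x ^ 2 + p x) q (Icc (-a) a)) {u : ℝ → ℂ} (hU : Continuous U)
    (hu : EqOn U u (Icc (-a) a)) {x : ℝ} (hx : x ∈ Icc (-a) a) :
    transmutation a q (φ 0) u x = U x + (fstIntegral S U x + sndIntegral D U x) := by
  have hx' : -x ∈ Icc (-a) a := ⟨by linarith [hx.2], by linarith [hx.1]⟩
  have hS : Continuous fun t => S ((x + t) / 2) ((x - t) / 2) * U t :=
    (h.continuous_fst.comp (f := fun t : ℝ => ((x + t) / 2, (x - t) / 2)) (by fun_prop)).mul hU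
  have hD : Continuous fun t => D ((x + t) / 2) ((x - t) / 2) * U t :=
    (h.continuous_snd.comp (f := fun t : ℝ => ((x + t) / 2, (x - t) / 2)) (by fun_prop)).mul hU
  have h1 : ∫ t in (-x)..x, paramKernel a q (φ 0) x t * u t =
      ∫ t in (-x)..x, (S ((x + t) / 2) ((x - t) / 2) * U t / 2 +
        D ((x + t) / 2) ((x - t) / 2) * U t / 2) := by
    refine intervalIntegral.integral_congr fun t ht => ?_
    have ht' : t ∈ Icc (-a) a := uIcc_subset_Icc hx' hx ht
    simp only [h.paramKernel_eq hφ hp ha hq hx ht', ← hu ht']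
    ring
  have h2 := intervalIntegral.smul_integral_comp_sub_mul (a := 0) (b := x)
    (fun t => S ((x + t) / 2) ((x - t) / 2) * U t) 2 x
  have h3 := intervalIntegral.smul_integral_comp_mul_sub (a := 0) (b := x)
    (fun t => D ((x + t) / 2) ((x - t) / 2) * U t) 2 x
  rw [show x - 2 * x = -x by ring, show x - 2 * 0 = x by ring] at h2
  rw [show 2 * x - x = x by ring, show 2 * 0 - x = -x by ring] at h3
  have h4 : ∀ τ, (x + (x - 2 * τ)) / 2 = x - τ := fun τ => by ring
  have h5 : ∀ τ, (x - (x - 2 * τ)) / 2 = τ := fun τ => by ring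
  have h6 : ∀ τ, (x + (2 * τ - x)) / 2 = τ := fun τ => by ring
  have h7 : ∀ τ, (x - (2 * τ - x)) / 2 = x - τ := fun τ => by ring
  simp only [h4, h5] at h2
  simp only [h6, h7] at h3
  rw [transmutation, h1, intervalIntegral.integral_add ((hS.div_const 2).intervalIntegrable _ _)
    ((hD.div_const 2).intervalIntegrable _ _), intervalIntegral.integral_div,
    intervalIntegral.integral_div, ← h2, ← h3, hu hx, fstIntegral, sndIntegral]
  simp only [Complex.real_smul, Complex.ofReal_ofNat]
  ring

end IsDiracGoursat

/-- Intertwining of `d/dx - φ` and `d/dx` by the transmutation operators of the potentials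
`φ² + φ'` and `φ² - φ'`. -/
theorem hasDerivWithinAt_transmutation {φ p : ℝ → ℂ} (hφ : ∀ x, HasDerivAt φ (p x) x)
    (hp : Continuous p) {a : ℝ} (ha : 0 < a) {q₁ q₂ : ℝ → ℂ}
    (hq₁ : EqOn (fun x => φ x ^ 2 + p x) q₁ (Icc (-a) a))
    (hq₂ : EqOn (fun x => φ x ^ 2 - p x) q₂ (Icc (-a) a)) {u : ℝ → ℂ}
    (hu : DifferentiableOn ℝ u (Icc (-a) a))
    (hu' : ContinuousOn (derivWithin u (Icc (-a) a)) (Icc (-a) a)) {x : ℝ}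
    (hx : x ∈ Icc (-a) a) :
    HasDerivWithinAt (transmutation a q₁ (φ 0) u)
      (φ x * transmutation a q₁ (φ 0) u x +
        transmutation a q₂ (-φ 0) (derivWithin u (Icc (-a) a)) x) (Icc (-a) a) x := by
  have hφc : Continuous φ := continuous_iff_continuousAt.2 fun x => (hφ x).continuousAt
  obtain ⟨S, D, h⟩ := exists_isDiracGoursat hφc
  obtain ⟨U, U', hU, hU', hUu, hUu'⟩ := exists_hasDerivAt_extension (by linarith : -a ≤ a)
    hu.continuousOn (w' := derivWithin u (Icc (-a) a)) (fun y hy =>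
      (hu y (Ioo_subset_Icc_self hy)).hasDerivWithinAt.hasDerivAt (Icc_mem_nhds hy.1 hy.2)) hu'
  have hUc : Continuous U := continuous_iff_continuousAt.2 fun x => (hU x).continuousAt
  have h1 : ∀ y ∈ Icc (-a) a, transmutation a q₁ (φ 0) u y =
      U y + (fstIntegral S U y + sndIntegral D U y) := fun y hy =>
    h.transmutation_eq hφ hp ha hq₁ hUc hUu hy
  have h2 : transmutation a q₂ (-φ 0) (derivWithin u (Icc (-a) a)) x =
      U' x + (fstIntegral S U' x + -sndIntegral D U' x) := by
    rw [← sndIntegral_neg]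
    refine h.neg.transmutation_eq (p := fun y => -p y) (fun y => (hφ y).neg) hp.neg ha
      (fun y hy => ?_) hU' hUu' hx
    rw [← hq₂ hy]
    change (-φ y) ^ 2 + -p y = φ y ^ 2 - p y
    ring
  have h3 := ((hU x).add ((h.hasDerivAt_fstIntegral hφc hU hU' x).add
    (h.hasDerivAt_sndIntegral hφc hU hU' x))).hasDerivWithinAt (s := Icc (-a) a)
  refine (h3.congr h1 (h1 x hx)).congr_deriv ?_
  rw [h2, h1 x hx]
  ring

/-- The logarithmic derivative of a nonvanishing solution of `f'' = q f` extends to a `C¹` function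
`φ` on the line with `φ' + φ² = q` on `[-a, a]`. -/
theorem exists_logDeriv_extension {a : ℝ} (ha : 0 < a) {q f : ℝ → ℂ}
    (hq : ContinuousOn q (Icc (-a) a)) (hf1 : ContDiffOn ℝ 1 f (Icc (-a) a))
    (hf2 : ContDiffOn ℝ 2 f (Ioo (-a) a))
    (hfq : ∀ x ∈ Ioo (-a) a, deriv (deriv f) x - q x * f x = 0)
    (hf_ne : ∀ x ∈ Icc (-a) a, f x ≠ 0) :
    ∃ φ p : ℝ → ℂ, (∀ x, HasDerivAt φ (p x) x) ∧ Continuous p ∧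
      EqOn φ (fun x => derivWithin f (Icc (-a) a) x / f x) (Icc (-a) a) ∧
      EqOn (fun x => φ x ^ 2 + p x) q (Icc (-a) a) ∧
      EqOn (fun x => φ x ^ 2 - p x) (darbouxPotential a q f) (Icc (-a) a) := by
  have hu : UniqueDiffOn ℝ (Icc (-a) a) := uniqueDiffOn_Icc (by linarith)
  have hf' : ContinuousOn (derivWithin f (Icc (-a) a)) (Icc (-a) a) :=
    hf1.continuousOn_derivWithin hu le_rfl
  have hw : ContinuousOn (fun x => derivWithin f (Icc (-a) a) x / f x) (Icc (-a) a) :=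
    hf'.div hf1.continuousOn hf_ne
  have heq : ∀ y ∈ Ioo (-a) a, derivWithin f (Icc (-a) a) y = deriv f y := fun y hy =>
    derivWithin_of_mem_nhds (Icc_mem_nhds hy.1 hy.2)
  have hd : ∀ x ∈ Ioo (-a) a, HasDerivAt (fun x => derivWithin f (Icc (-a) a) x / f x)
      (q x - (derivWithin f (Icc (-a) a) x / f x) ^ 2) x := by
    intro x hx
    have hnhds : Ioo (-a) a ∈ nhds x := isOpen_Ioo.mem_nhds hx
    have hfx := hf_ne x (Ioo_subset_Icc_self hx)
    have hd1 : HasDerivAt f (deriv f x) x :=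
      ((hf2.contDiffAt hnhds).differentiableAt (by norm_num)).hasDerivAt
    have hd2 : HasDerivAt (deriv f) (deriv (deriv f) x) x := by
      have h1 : ContDiffOn ℝ 1 (deriv f) (Ioo (-a) a) :=
        hf2.deriv_of_isOpen isOpen_Ioo (by norm_num)
      exact ((h1.contDiffAt hnhds).differentiableAt (by norm_num)).hasDerivAt
    have hd3 := (hd2.div hd1 hfx).congr_of_eventuallyEq
      (f₁ := fun x => derivWithin f (Icc (-a) a) x / f x) (by
        filter_upwards [hnhds] with y hy
        simp only [heq y hy, Pi.div_apply])
    refine hd3.congr_deriv ?_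
    rw [heq x hx, sub_eq_zero.1 (hfq x hx)]
    field_simp
  obtain ⟨φ, p, hφ, hp, hφe, hpe⟩ := exists_hasDerivAt_extension (by linarith : -a ≤ a) hw hd
    (hq.sub (hw.pow 2))
  refine ⟨φ, p, hφ, hp, hφe, fun x hx => ?_, fun x hx => ?_⟩
  · simp only [hφe hx, hpe hx, add_sub_cancel]
  · simp only [hφe hx, hpe hx, darbouxPotential]
    ring

end Transmutation

end

/-! ### Induction for the generalized derivatives. -/

theorem mainTheorem9 (a : ℝ) (ha : 0 < a) (q f : ℝ → ℂ)
    (hq : ContinuousOn q (Icc (-a) a))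
    (hf1 : ContDiffOn ℝ 1 f (Icc (-a) a))
    (hf2 : ContDiffOn ℝ 2 f (Ioo (-a) a))
    (hfq : ∀ x ∈ Ioo (-a) a, deriv (deriv f) x - q x * f x = 0)
    (hf_ne : ∀ x ∈ Icc (-a) a, f x ≠ 0)
    (hf0 : f 0 = 1)
    (h : ℂ) (hh : h = deriv f 0)
    (T₁ T₂ : (ℝ → ℂ) → ℝ → ℂ)
    (hT₁ : T₁ = Transmutation.transmutation a q h)
    (hT₂ : T₂ = Transmutation.transmutation a (Transmutation.darbouxPotential a q f) (-h))
    (n : ℕ) (u : ℝ → ℂ) (hu : ContDiffOn ℝ n u (Icc (-a) a))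
    (g : ℝ → ℂ) (hg : ∀ x ∈ Icc (-a) a, g x = 1 / f x * T₁ u x) :
    (∀ k < n, DifferentiableOn ℝ (Transmutation.genDeriv a f g k) (Icc (-a) a)) ∧
    (∀ k ≤ n, Odd k → ∀ x ∈ Icc (-a) a,
      Transmutation.genDeriv a f g k x =
        f x * T₂ (iteratedDerivWithin k u (Icc (-a) a)) x) ∧
    (∀ k ≤ n, Even k → ∀ x ∈ Icc (-a) a,
      Transmutation.genDeriv a f g k x =
        1 / f x * T₁ (iteratedDerivWithin k u (Icc (-a) a)) x) := by
  obtain ⟨φ, p, hφ, hp, hφf, hq₁, hq₂⟩ :=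
    Transmutation.exists_logDeriv_extension ha hq hf1 hf2 hfq hf_ne
  have hud : UniqueDiffOn ℝ (Icc (-a) a) := uniqueDiffOn_Icc (by linarith)
  have h0 : φ 0 = h := by
    have h0m : (0 : ℝ) ∈ Icc (-a) a := ⟨by linarith, ha.le⟩
    rw [hφf h0m]
    beta_reduce
    rw [hf0, div_one, hh,
      derivWithin_of_mem_nhds (Icc_mem_nhds (by linarith) ha)]
  have hfd : ∀ x ∈ Icc (-a) a, HasDerivWithinAt f (φ x * f x) (Icc (-a) a) x := by
    intro x hx
    have h1 := (hf1.differentiableOn one_ne_zero x hx).hasDerivWithinAt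
    rwa [hφf hx, div_mul_cancel₀ _ (hf_ne x hx)]
  have hdiff : ∀ k < n, DifferentiableOn ℝ (iteratedDerivWithin k u (Icc (-a) a)) (Icc (-a) a) :=
    fun k hk => hu.differentiableOn_iteratedDerivWithin (by exact_mod_cast hk) hud
  have hcont : ∀ k < n, ContinuousOn
      (derivWithin (iteratedDerivWithin k u (Icc (-a) a)) (Icc (-a) a)) (Icc (-a) a) := by
    intro k hk
    rw [← iteratedDerivWithin_succ]
    exact hu.continuousOn_iteratedDerivWithin (by exact_mod_cast hk) hud
  have hstep₁ : ∀ k < n, ∀ x ∈ Icc (-a) a,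
      HasDerivWithinAt (fun y => 1 / f y * T₁ (iteratedDerivWithin k u (Icc (-a) a)) y)
        (1 / f x * T₂ (iteratedDerivWithin (k + 1) u (Icc (-a) a)) x) (Icc (-a) a) x := by
    intro k hk x hx
    have h1 := Transmutation.hasDerivWithinAt_transmutation hφ hp ha hq₁ hq₂ (hdiff k hk)
      (hcont k hk) hx
    rw [h0, ← hT₁, ← hT₂, ← iteratedDerivWithin_succ] at h1
    -- Since (1/f)' = -φ/f, the term φ T₁ cancels.
    have h2 := ((hasDerivWithinAt_const x _ (1 : ℂ)).div (hfd x hx) (hf_ne x hx)).mul h1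
    refine h2.congr_deriv ?_
    have := hf_ne x hx
    simp only [Pi.div_apply]
    field_simp
    ring
  have hstep₂ : ∀ k < n, ∀ x ∈ Icc (-a) a,
      HasDerivWithinAt (fun y => f y * T₂ (iteratedDerivWithin k u (Icc (-a) a)) y)
        (f x * T₁ (iteratedDerivWithin (k + 1) u (Icc (-a) a)) x) (Icc (-a) a) x := by
    intro k hk x hx
    -- The same relation for -φ: the potentials trade places, and now f' = φf cancels the term -φ
    -- T₂.
    have h1 := Transmutation.hasDerivWithinAt_transmutation (φ := fun y => -φ y)
      (p := fun y => -p y) (q₁ := Transmutation.darbouxPotential a q f) (q₂ := q)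
      (fun y => (hφ y).neg) hp.neg ha (fun y hy => by rw [← hq₂ hy]; ring)
      (fun y hy => by rw [← hq₁ hy]; ring) (hdiff k hk) (hcont k hk) hx
    rw [h0, neg_neg, ← hT₁, ← hT₂, ← iteratedDerivWithin_succ] at h1
    refine ((hfd x hx).mul h1).congr_deriv ?_
    ring
  have hmain : ∀ k ≤ n,
      (Odd k → ∀ x ∈ Icc (-a) a, Transmutation.genDeriv a f g k x =
        f x * T₂ (iteratedDerivWithin k u (Icc (-a) a)) x) ∧
      (Even k → ∀ x ∈ Icc (-a) a, Transmutation.genDeriv a f g k x =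
        1 / f x * T₁ (iteratedDerivWithin k u (Icc (-a) a)) x) := by
    intro k
    induction k with
    | zero =>
      refine fun _ => ⟨fun hk => absurd hk (by decide), fun _ x hx => ?_⟩
      rw [iteratedDerivWithin_zero]
      exact hg x hx
    | succ k ih =>
      intro hk
      obtain ⟨ihodd, iheven⟩ := ih (by omega)
      constructor
      · intro hodd x hx
        have hev : Even k := by rwa [Nat.odd_add_one, Nat.not_odd_iff_even] at hodd
        have h1 := ((hstep₁ k hk x hx).congr (iheven hev) (iheven hev x hx)).derivWithin
          (hud x hx)
        have := hf_ne x hx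
        simp only [Transmutation.genDeriv, h1, hev.neg_one_pow, zpow_one]
        field_simp
      · intro hev x hx
        have hodd : Odd k := by rwa [Nat.even_add_one, Nat.not_even_iff_odd] at hev
        have h1 := ((hstep₂ k hk x hx).congr (ihodd hodd) (ihodd hodd x hx)).derivWithin
          (hud x hx)
        have := hf_ne x hx
        simp only [Transmutation.genDeriv, h1, hodd.neg_one_pow, zpow_neg, zpow_one]
        field_simp
  refine ⟨fun k hk x hx => ?_, fun k hk => (hmain k hk).1, fun k hk => (hmain k hk).2⟩
  rcases Nat.even_or_odd k with hev | hodd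
  · have := (hmain k hk.le).2 hev
    exact ((hstep₁ k hk x hx).congr this (this x hx)).differentiableWithinAt
  · have := (hmain k hk.le).1 hodd
    exact ((hstep₂ k hk x hx).congr this (this x hx)).differentiableWithinAt
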